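/- **Setting.** Let $U$ (URIs), $B$ (blank nodes), $L$ (literals), $V$ (variables) be pairwise disjoint, countably infinite sets; elements of $U\cup B\cup L$ are called terms. Fix an injective binary representation $U\cup B\cup L\cup V\to\{0,1\}^*$ and total orders on $U,B,L$, where every element of $U$ has only finitely many predecessors. *RDF and SPARQL.* A triple is an element of $(U\cup B)\times U\times(U\cup B\cup L)$. A valuation is a partial map $\mu$ from $V$ to $U\cup B\cup L$. Valuations $\mu_1,\mu_2$ are compatible, $\mu_1\sim\mu_2$, if they agree on $\mathrm{dom}(\mu_1)\cap\mathrm{dom}(\mu_2)$. Filter conditions are $?x=c$ (with $c\in U\cup L$), $?x=?y$, $\mathrm{bound}(?x)$ and their combinations by $\neg,\wedge,\vee$; $\mu$ satisfies $?x=c$ if $\mu(?x)$ is defined and equals $c$, $?x=?y$ if $\mu(?x),\mu(?y)$ are defined and equal, $\mathrm{bound}(?x)$ if $\mu(?x)$ is defined, and the connectives have their Boolean meaning. SPARQL expressions are the triple patterns in $(V\cup U)\times(V\cup U)\times(V\cup U\cup L)$ and $(P_1\,\mathsf{AND}\,P_2)$, $(P_1\,\mathsf{UNION}\,P_2)$,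 $(P_1\,\mathsf{OPT}\,P_2)$, $(P_1\,\mathsf{FILTER}\,R)$. For a (possibly infinite) set $G$ of triples, $[\![tp]\!]_G$ is the set of valuations $\mu$ whose domain is the set of variables of $tp$ and with $\mu[tp]\in G$; $[\![P_1\,\mathsf{AND}\,P_2]\!]_G=[\![P_1]\!]_G\bowtie[\![P_2]\!]_G=\{\mu_1\cup\mu_2:\mu_i\in[\![P_i]\!]_G,\ \mu_1\sim\mu_2\}$; $[\![P_1\,\mathsf{UNION}\,P_2]\!]_G=[\![P_1]\!]_G\cup[\![P_2]\!]_G$; $[\![P_1\,\mathsf{OPT}\,P_2]\!]_G=([\![P_1]\!]_G\bowtie[\![P_2]\!]_G)\cup\{\mu_1\in[\![P_1]\!]_G:\mu_1\not\sim\mu_2\text{ for all }\mu_2\in[\![P_2]\!]_G\}$; and $[\![P_1\,\mathsf{FILTER}\,R]\!]_G$ is the set of $\mu\in[\![P_1]\!]_G$ that satisfy $R$. $P$ is satisfiable if $[\![P]\!]_G\ne\emptyset$ for some $G$. *Webs.* A Web of Linked Data is $W=(D,\mathrm{data},\mathrm{adoc})$ with a finite or countably infinite set $D$ of documents, a map $\mathrm{data}$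 from $D$ to finite sets of triples, and a partial surjective map $\mathrm{adoc}:U\to D$, such that (*) any two different documents have different sets of blank nodes in their data. The full-Web result of $P$ over $W$ is $[\![P]\!]_{\bigcup_{d\in D}\mathrm{data}(d)}$. *Encodings.* Over a fixed finite alphabet, terms and variables are encoded by their binary representations, a triple is encoded as $\langle\mathrm{enc}(s),\mathrm{enc}(p),\mathrm{enc}(o)\rangle$, a finite set of triples as $\langle\!\langle\mathrm{enc}(t_1),\dots,\mathrm{enc}(t_n)\rangle\!\rangle$ in lexicographic order, a document $d$ as $\mathrm{enc}(d)=\mathrm{enc}(\mathrm{data}(d))$, and $W$ as the finite or infinite word $\sharp\,\mathrm{enc}(u_1)\,\mathrm{enc}(\mathrm{adoc}(u_1))\,\sharp\,\mathrm{enc}(u_2)\,\mathrm{enc}(\mathrm{adoc}(u_2))\,\sharp\cdots$, where $u_1,u_2,\dots$ lists the domain of $\mathrm{adoc}$ in increasing order. A SPARQL expression is encoded by writing it out as a fully parenthesized word. *LD machines.* An LD machine is a deterministic Turing machine with finitely many states and tape symbols, disjoint sets of accepting and rejecting states, and five tapes: a read-only input tape; a read-only right-infinite Web tape, accessible only through the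 expand procedure; a two-way infinite work tape; a right-infinite link traversal tape; and an append-only output tape. The work, link traversal and output tapes are initially empty. It operates like an ordinary Turing machine, except that in a special state *expand* it first performs the expand procedure: if the suffix of the word on the link traversal tape is $\mathrm{enc}(u)$ for some $u\in U$ (the longest such suffix counts) and $\sharp\,\mathrm{enc}(u)\,\mathrm{enc}(\mathrm{adoc}(u))\,\sharp$ occurs on the Web tape, it appends $\mathrm{enc}(\mathrm{adoc}(u))\,\sharp$ to the right end of the word on the link traversal tape; otherwise it appends $\sharp$. For a set $\mathcal W$ of Webs, a set $\mathcal X$ of finite structures and $DP\subseteq\mathcal W\times\mathcal X$, the decision problem for $DP$ is LD machine decidable if there is an LD machine which, for all $W\in\mathcal W$ and $X\in\mathcal X$, with $\mathrm{enc}(W)$ on the Web tape and $\mathrm{enc}(X)$ on the input tape, halts in an accepting state if $(W,X)\in DP$ and halts in a rejecting state otherwise. **Theorem.** The following problem is not LD machine decidable: given a (possibly infinite) Web of Linked Data $W$ and a satisfiable SPARQL expression $P$, is the full-Web result of $P$ over $W$ finite? The same holds if (*) is replaced by the requirement that different documents have no blank node in common. -/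

import Mathlib

namespace LinkedData

/-! ## RDF

`U`, `B`, `L`, `V` are the sets of URIs, blank nodes, literals and query variables. -/

/-- RDF terms: the disjoint union of URIs, blank nodes and literals. -/
inductive Term (U B L : Type) : Type where
  | uri (u : U)
  | bnode (b : B)
  | lit (l : L)

/-- RDF triples: elements of `(U ∪ B) × U × (U ∪ B ∪ L)`. -/
structure Triple (U B L : Type) : Type where
  subj : U ⊕ B
  pred : U
  obj : Term U B L

section RDF

variable {U B L V : Type}

/-- The subject of a triple as an RDF term. -/
def Triple.subjTerm (t : Triple U B L) : Term U B L :=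
  Sum.elim Term.uri Term.bnode t.subj

/-- The set of RDF terms of a triple. -/
def Triple.terms (t : Triple U B L) : Set (Term U B L) :=
  {t.subjTerm, Term.uri t.pred, t.obj}

/-- The blank nodes that occur in a set of triples. -/
def bnodes (G : Set (Triple U B L)) : Set B :=
  {b | ∃ t ∈ G, Term.bnode b ∈ t.terms}

/-- RDF terms, ordered with URIs before blank nodes before literals. -/
def Term.key : Term U B L → U ⊕ₗ (B ⊕ₗ L)
  | .uri u => toLex (Sum.inl u)
  | .bnode b => toLex (Sum.inr (toLex (Sum.inl b)))
  | .lit l => toLex (Sum.inr (toLex (Sum.inr l)))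

theorem Term.key_injective : Function.Injective (Term.key : Term U B L → _) := by
  intro a b h
  cases a <;> cases b <;> simp_all [Term.key]

/-- The key for the lexicographic order of triples. -/
def Triple.key (t : Triple U B L) : (U ⊕ₗ B) ×ₗ (U ×ₗ (U ⊕ₗ (B ⊕ₗ L))) :=
  toLex (toLex t.subj, toLex (t.pred, t.obj.key))

theorem Triple.key_injective : Function.Injective (Triple.key : Triple U B L → _) := by
  rintro ⟨s, p, o⟩ ⟨s', p', o'⟩ h
  simp only [Triple.key, EmbeddingLike.apply_eq_iff_eq, Prod.mk.injEq] at h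
  obtain ⟨h1, h2, h3⟩ := h
  rw [h1, h2, Term.key_injective h3]

/-- The lexicographic total order of triples. -/
noncomputable instance [LinearOrder U] [LinearOrder B] [LinearOrder L] :
    LinearOrder (Triple U B L) :=
  LinearOrder.lift' Triple.key Triple.key_injective

end RDF

/-! ## SPARQL -/

/-- Filter conditions. -/
inductive Filter (U L V : Type) : Type where
  | eqConst (x : V) (c : U ⊕ L)
  | eqVar (x y : V)
  | bound (x : V)
  | neg (R : Filter U L V)
  | and (R₁ R₂ : Filter U L V)
  | or (R₁ R₂ : Filter U L V)

/-- Triple patterns: elements of `(V ∪ U) × (V ∪ U) × (V ∪ U ∪ L)`. -/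
structure TriplePattern (U L V : Type) : Type where
  subj : V ⊕ U
  pred : V ⊕ U
  obj : V ⊕ (U ⊕ L)

/-- SPARQL expressions. -/
inductive Expr (U L V : Type) : Type where
  | tp (p : TriplePattern U L V)
  | and (P₁ P₂ : Expr U L V)
  | union (P₁ P₂ : Expr U L V)
  | opt (P₁ P₂ : Expr U L V)
  | filter (P : Expr U L V) (R : Filter U L V)

/-- Valuations: partial mappings from variables to RDF terms (`none` means undefined). -/
abbrev Valuation (U B L V : Type) : Type := V → Option (Term U B L)

section SPARQL

variable {U B L V : Type}

/-- URIs and literals as RDF terms. -/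
def constTerm : U ⊕ L → Term U B L := Sum.elim Term.uri Term.lit

namespace Valuation

/-- The domain of a valuation. -/
def dom (μ : Valuation U B L V) : Set V := {v | μ v ≠ none}

/-- Two valuations are compatible if they agree on the common part of their domains. -/
def Compatible (μ₁ μ₂ : Valuation U B L V) : Prop :=
  ∀ v ∈ μ₁.dom ∩ μ₂.dom, μ₁ v = μ₂ v

/-- The union of two (compatible) valuations. -/
def union (μ₁ μ₂ : Valuation U B L V) : Valuation U B L V :=
  fun v => (μ₁ v).or (μ₂ v)

/-- `μ.Satisfies R`: the valuation `μ` satisfies the filter condition `R`. -/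
def Satisfies (μ : Valuation U B L V) : Filter U L V → Prop
  | .eqConst x c => μ x = some (constTerm c)
  | .eqVar x y => x ∈ μ.dom ∧ y ∈ μ.dom ∧ μ x = μ y
  | .bound x => x ∈ μ.dom
  | .neg R => ¬ μ.Satisfies R
  | .and R₁ R₂ => μ.Satisfies R₁ ∧ μ.Satisfies R₂
  | .or R₁ R₂ => μ.Satisfies R₁ ∨ μ.Satisfies R₂

/-- Replace a variable or URI by a term, according to `μ`. -/
def instVU (μ : Valuation U B L V) : V ⊕ U → Option (Term U B L) :=
  Sum.elim μ (fun u => some (Term.uri u))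

/-- Replace a variable, URI or literal by a term, according to `μ`. -/
def instVUL (μ : Valuation U B L V) : V ⊕ (U ⊕ L) → Option (Term U B L) :=
  Sum.elim μ (fun c => some (constTerm c))

end Valuation

/-- The variables of a triple pattern. -/
def TriplePattern.vars (p : TriplePattern U L V) : Set V :=
  {v | p.subj = Sum.inl v ∨ p.pred = Sum.inl v ∨ p.obj = Sum.inl v}

/-- `p.InstanceOf μ t`: replacing the variables of `p` according to `μ` yields the triple `t`. -/
def TriplePattern.InstanceOf (p : TriplePattern U L V) (μ : Valuation U B L V)
    (t : Triple U B L) : Prop :=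
  μ.instVU p.subj = some t.subjTerm ∧ μ.instVU p.pred = some (Term.uri t.pred) ∧
    μ.instVUL p.obj = some t.obj

/-- Join of sets of valuations. -/
def join (Ω₁ Ω₂ : Set (Valuation U B L V)) : Set (Valuation U B L V) :=
  {μ | ∃ μ₁ ∈ Ω₁, ∃ μ₂ ∈ Ω₂, μ₁.Compatible μ₂ ∧ μ = μ₁.union μ₂}

/-- Difference of sets of valuations. -/
def difference (Ω₁ Ω₂ : Set (Valuation U B L V)) : Set (Valuation U B L V) :=
  {μ ∈ Ω₁ | ∀ μ₂ ∈ Ω₂, ¬ μ.Compatible μ₂}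

/-- Left outer-join of sets of valuations. -/
def leftOuterJoin (Ω₁ Ω₂ : Set (Valuation U B L V)) : Set (Valuation U B L V) :=
  join Ω₁ Ω₂ ∪ difference Ω₁ Ω₂

/-- Evaluation of a SPARQL expression over a (possibly infinite) set of triples. -/
def Expr.eval : Expr U L V → Set (Triple U B L) → Set (Valuation U B L V)
  | .tp p, G => {μ | μ.dom = p.vars ∧ ∃ t ∈ G, p.InstanceOf μ t}
  | .and P₁ P₂, G => join (P₁.eval G) (P₂.eval G)
  | .union P₁ P₂, G => P₁.eval G ∪ P₂.eval G
  | .opt P₁ P₂, G => leftOuterJoin (P₁.eval G) (P₂.eval G)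
  | .filter P R, G => {μ ∈ P.eval G | μ.Satisfies R}

/-- A SPARQL expression is satisfiable if it has a solution in some set of triples. -/
def Expr.Satisfiable (B : Type) (P : Expr U L V) : Prop :=
  ∃ G : Set (Triple U B L), (P.eval G).Nonempty

end SPARQL

/-! ## Webs of Linked Data -/

/-- The data of a Web of Linked Data: a countable set of documents, the finite set of triples of
each document, and the partial surjective mapping from URIs to (authoritative) documents. The
requirement on blank nodes is stated separately below. -/
structure Web (U B L : Type) : Type 1 where
  Doc : Type
  countable_doc : Countable Doc
  data : Doc → Finset (Triple U B L)
  adoc : U → Option Doc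
  adoc_surjective : ∀ d, ∃ u, adoc u = some d

section Web

variable {U B L V : Type}

/-- The set of blank nodes in the data of a document. -/
def Web.docBNodes (W : Web U B L) (d : W.Doc) : Set B :=
  bnodes (W.data d : Set (Triple U B L))

/-- Different documents have different sets of blank nodes. -/
def Web.UniqueBNodes (W : Web U B L) : Prop :=
  ∀ d₁ d₂ : W.Doc, d₁ ≠ d₂ → W.docBNodes d₁ ≠ W.docBNodes d₂

/-- Different documents have no blank node in common. -/
def Web.DisjointBNodes (W : Web U B L) : Prop :=
  ∀ d₁ d₂ : W.Doc, d₁ ≠ d₂ → Disjoint (W.docBNodes d₁) (W.docBNodes d₂)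

/-- The set of all triples in a Web. -/
def Web.allData (W : Web U B L) : Set (Triple U B L) :=
  ⋃ d, (W.data d : Set (Triple U B L))

/-- The result of a SPARQL expression over a Web under full-Web semantics. -/
def fullWebEval (P : Expr U L V) (W : Web U B L) : Set (Valuation U B L V) :=
  P.eval W.allData

end Web

/-! ## Encodings

Everything is encoded over a finite alphabet, starting from a binary representation
`code : Term U B L ⊕ V → List Bool` of URIs, blank nodes, literals and variables. -/

/-- The alphabet of the encodings: binary digits, the separator `♯`, the brackets `⟨`, `⟩` of
triples, the brackets `⟪`, `⟫` of sets of triples, the comma, and the symbols in which SPARQL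
expressions are written. -/
inductive Sym : Type where
  | bit (b : Bool)
  | sharp
  | langle | rangle
  | llangle | rrangle
  | comma
  | lparen | rparen
  | kwAnd | kwUnion | kwOpt | kwFilter
  | eq | bound | neg | land | lor

section Encoding

variable {U B L V : Type} (code : Term U B L ⊕ V → List Bool)

/-- The encoding of an RDF term. -/
def encTerm (x : Term U B L) : List Sym := (code (Sum.inl x)).map Sym.bit

/-- The encoding of a variable. -/
def encVar (v : V) : List Sym := (code (Sum.inr v)).map Sym.bit

/-- The encoding `⟨ enc(s) , enc(p) , enc(o) ⟩` of a triple. -/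
def encTriple (t : Triple U B L) : List Sym :=
  [.langle] ++ encTerm code t.subjTerm ++ [.comma] ++ encTerm code (.uri t.pred) ++ [.comma] ++
    encTerm code t.obj ++ [.rangle]

/-- The encoding `⟪ enc(t₁) , … , enc(tₙ) ⟫` of a finite set of triples, listed in order. -/
noncomputable def encTriples [LinearOrder U] [LinearOrder B] [LinearOrder L]
    (T : Finset (Triple U B L)) : List Sym :=
  [.llangle] ++ List.intercalate [.comma] ((T.sort).map (encTriple code)) ++ [.rrangle]

/-- The part `enc(u) enc(adoc(u)) ♯` of the encoding of a Web (empty if `adoc(u)` is undefined). -/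
noncomputable def encEntry [LinearOrder U] [LinearOrder B] [LinearOrder L]
    (W : Web U B L) (u : U) : List Sym :=
  match W.adoc u with
  | none => []
  | some d => encTerm code (.uri u) ++ encTriples code (W.data d) ++ [.sharp]

/-- The part of the encoding of a Web that is about the URIs up to `u`. -/
noncomputable def encWebUpTo [LinearOrder U] [LocallyFiniteOrderBot U] [LinearOrder B]
    [LinearOrder L] (W : Web U B L) (u : U) : List Sym :=
  [.sharp] ++ ((Finset.Iic u).sort).flatMap (encEntry code W)

open Classical in
/-- The (finite or infinite) word `♯ enc(u₁) enc(adoc(u₁)) ♯ enc(u₂) enc(adoc(u₂)) ♯ …` where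
`u₁, u₂, …` are the URIs in the domain of `adoc` in increasing order, as the content of a
right-infinite tape: the common extension of the words `encWebUpTo code W u`, with blanks (`none`)
behind its end if it is finite. -/
noncomputable def encWeb [LinearOrder U] [LocallyFiniteOrderBot U] [LinearOrder B]
    [LinearOrder L] (W : Web U B L) (k : ℕ) : Option Sym :=
  if h : ∃ u, k < (encWebUpTo code W u).length then (encWebUpTo code W h.choose)[k]? else none

/-- The encoding of a URI or literal. -/
def encConst (c : U ⊕ L) : List Sym := encTerm code (constTerm c)

/-- The encoding of a filter condition, fully parenthesized. -/
def encFilter : Filter U L V → List Sym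
  | .eqConst x c => [.lparen] ++ encVar code x ++ [.eq] ++ encConst code c ++ [.rparen]
  | .eqVar x y => [.lparen] ++ encVar code x ++ [.eq] ++ encVar code y ++ [.rparen]
  | .bound x => [.bound, .lparen] ++ encVar code x ++ [.rparen]
  | .neg R => [.lparen, .neg] ++ encFilter R ++ [.rparen]
  | .and R₁ R₂ => [.lparen] ++ encFilter R₁ ++ [.land] ++ encFilter R₂ ++ [.rparen]
  | .or R₁ R₂ => [.lparen] ++ encFilter R₁ ++ [.lor] ++ encFilter R₂ ++ [.rparen]

/-- The encoding of a triple pattern. -/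
def encPattern (p : TriplePattern U L V) : List Sym :=
  [.langle] ++ Sum.elim (encVar code) (fun u => encTerm code (.uri u)) p.subj ++ [.comma] ++
    Sum.elim (encVar code) (fun u => encTerm code (.uri u)) p.pred ++ [.comma] ++
    Sum.elim (encVar code) (encConst code) p.obj ++ [.rangle]

/-- The encoding of a SPARQL expression, fully parenthesized. -/
def encExpr : Expr U L V → List Sym
  | .tp p => encPattern code p
  | .and P₁ P₂ => [.lparen] ++ encExpr P₁ ++ [.kwAnd] ++ encExpr P₂ ++ [.rparen]
  | .union P₁ P₂ => [.lparen] ++ encExpr P₁ ++ [.kwUnion] ++ encExpr P₂ ++ [.rparen]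
  | .opt P₁ P₂ => [.lparen] ++ encExpr P₁ ++ [.kwOpt] ++ encExpr P₂ ++ [.rparen]
  | .filter P R => [.lparen] ++ encExpr P ++ [.kwFilter] ++ encFilter code R ++ [.rparen]

end Encoding

/-! ## LD machines -/

/-- A tape cell holds a blank (`none`), a symbol of the encodings, or an auxiliary symbol. -/
abbrev Cell (Aux : Type) : Type := Option (Sym ⊕ Aux)

/-- A right-infinite tape with a head. -/
structure RightTape (Aux : Type) : Type where
  cells : ℕ → Cell Aux
  pos : ℕ

/-- What an LD machine does in one step: the next state, the symbols written to the work tape and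
to the link traversal tape, the head movements (`none` means that the head stays) on the input
tape, the work tape and the link traversal tape, and the symbol, if any, appended to the output. -/
structure Action (State Aux : Type) : Type where
  next : State
  workWrite : Cell Aux
  linkWrite : Cell Aux
  inputMove : Option Turing.Dir
  workMove : Option Turing.Dir
  linkMove : Option Turing.Dir
  out : Option (Sym ⊕ Aux)

/-- An LD machine: a (deterministic) Turing machine with finitely many states and auxiliary tape
symbols. The transition function reads the state and the cells under the heads of the input tape,
the work tape and the link traversal tape; the machine halts where it is undefined. -/
structure LDMachine : Type 1 where
  State : Type
  finite_state : Finite State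
  Aux : Type
  finite_aux : Finite Aux
  start : State
  expand : State
  accepting : Set State
  rejecting : Set State
  disjoint_accepting_rejecting : Disjoint accepting rejecting
  trans : State → Cell Aux → Cell Aux → Cell Aux → Option (Action State Aux)

/-- A configuration of an LD machine (without the Web tape, whose content never changes). -/
structure Config (M : LDMachine) : Type where
  state : M.State
  input : Turing.Tape (Cell M.Aux)
  work : Turing.Tape (Cell M.Aux)
  link : RightTape M.Aux
  output : List (Sym ⊕ M.Aux)

section Machine

variable {U B L V : Type} {Aux : Type}

/-- Move the head of a two-way infinite tape. -/
def moveTape (t : Turing.Tape (Cell Aux)) : Option Turing.Dir → Turing.Tape (Cell Aux)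
  | none => t
  | some d => t.move d

namespace RightTape

/-- The cell under the head. -/
def head (t : RightTape Aux) : Cell Aux := t.cells t.pos

/-- Write to the cell under the head. -/
def write (t : RightTape Aux) (a : Cell Aux) : RightTape Aux :=
  { t with cells := Function.update t.cells t.pos a }

/-- Move the head; at the left end of the tape, a move to the left has no effect. -/
def move (t : RightTape Aux) : Option Turing.Dir → RightTape Aux
  | none => t
  | some .left => { t with pos := t.pos - 1 }
  | some .right => { t with pos := t.pos + 1 }

/-- The length of the word on the tape: all cells from there on are blank. -/
noncomputable def length (t : RightTape Aux) : ℕ := sInf {n | ∀ m, n ≤ m → t.cells m = none}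

/-- The word on the tape. -/
noncomputable def word (t : RightTape Aux) : List (Cell Aux) :=
  (List.range t.length).map t.cells

/-- Append a word to the right end of the word on the tape; the head does not move. -/
noncomputable def append (t : RightTape Aux) (w : List Sym) : RightTape Aux :=
  { t with cells := fun n =>
      if n < t.length then t.cells n else (w[n - t.length]?).map Sum.inl }

end RightTape

/-- The word `w` occurs on the Web tape `τ`. -/
def OccursOn (τ : ℕ → Option Sym) (w : List Sym) : Prop :=
  ∃ i, ∀ j (hj : j < w.length), τ (i + j) = some w[j]

variable (code : Term U B L ⊕ V → List Bool)

/-- The encoding of the URI `u` is a suffix of the word `w` of tape cells. -/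
def URISuffix (w : List (Cell Aux)) (u : U) : Prop :=
  (encTerm code (.uri u)).map (fun s => some (Sum.inl s)) <:+ w

/-- `u` is the URI whose encoding is the suffix of `w`; if several encodings of URIs are suffixes
of `w`, the longest one counts. -/
def IsURISuffix (w : List (Cell Aux)) (u : U) : Prop :=
  URISuffix code w u ∧
    ∀ u', URISuffix code w u' →
      (encTerm code (.uri u')).length ≤ (encTerm code (.uri u)).length

/-- `e` is what the expand procedure finds: the suffix of the word `w` on the link traversal tape
is the encoding of a URI `u`, `e` is the encoding of (the data of) a document, and the word
`♯ enc(u) e ♯` occurs on the Web tape `τ`. -/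
def IsLookupResult [LinearOrder U] [LinearOrder B] [LinearOrder L]
    (τ : ℕ → Option Sym) (w : List (Cell Aux)) (e : List Sym) : Prop :=
  ∃ u, IsURISuffix code w u ∧ (∃ T : Finset (Triple U B L), e = encTriples code T) ∧
    OccursOn τ ([.sharp] ++ encTerm code (.uri u) ++ e ++ [.sharp])

open Classical in
/-- The expand procedure with the Web tape `τ`, applied to the link traversal tape: append `e ♯`
if there is a lookup result `e` (at most one exists if `τ` encodes a Web), else append `♯`. -/
noncomputable def expandTape [LinearOrder U] [LinearOrder B] [LinearOrder L]
    (τ : ℕ → Option Sym) (t : RightTape Aux) : RightTape Aux :=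
  if h : ∃ e, IsLookupResult code τ t.word e then t.append (h.choose ++ [.sharp])
  else t.append [.sharp]

namespace LDMachine

variable (M : LDMachine)

/-- The initial configuration with the word `x` on the input tape. -/
def init (x : List Sym) : Config M where
  state := M.start
  input := Turing.Tape.mk₁ (x.map fun s => some (Sum.inl s))
  work := Turing.Tape.mk₁ []
  link := ⟨fun _ => none, 0⟩
  output := []

open Classical in
/-- Perform the expand procedure if the machine is in the expand state. -/
noncomputable def expandIfNeeded [LinearOrder U] [LinearOrder B] [LinearOrder L]
    (τ : ℕ → Option Sym) (c : Config M) : Config M :=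
  if c.state = M.expand then { c with link := expandTape code τ c.link } else c

/-- Perform one ordinary transition; `none` means that the machine halts. -/
def ordinaryStep (c : Config M) : Option (Config M) :=
  (M.trans c.state c.input.head c.work.head c.link.head).map fun a =>
    { state := a.next
      input := moveTape c.input a.inputMove
      work := moveTape (c.work.write a.workWrite) a.workMove
      link := (c.link.write a.linkWrite).move a.linkMove
      output := c.output ++ a.out.toList }

/-- One step of the computation with the Web tape `τ`: in the expand state, the expand procedure
is performed before the ordinary transition. -/
noncomputable def step [LinearOrder U] [LinearOrder B] [LinearOrder L]
    (τ : ℕ → Option Sym) (c : Config M) : Option (Config M) :=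
  M.ordinaryStep (M.expandIfNeeded code τ c)

/-- With the Web tape `τ` and the word `x` on the input tape, the machine halts after finitely
many steps, in a state of the set `S`. -/
def HaltsIn [LinearOrder U] [LinearOrder B] [LinearOrder L]
    (τ : ℕ → Option Sym) (x : List Sym) (S : Set M.State) : Prop :=
  ∃ c ∈ StateTransition.eval (M.step code τ) (M.init x), c.state ∈ S

end LDMachine

/-- LD machine decidability of a decision problem `DP ⊆ 𝒲 × 𝒳`, where the elements of `𝒳` are
encoded by `encX`: some LD machine, for all `W ∈ 𝒲` and `x ∈ 𝒳`, with `W` encoded on the Web tape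
and `x` encoded on the input tape, halts in an accepting state if `(W, x) ∈ DP`, and otherwise
halts in a rejecting state. -/
def LDMachineDecidable [LinearOrder U] [LocallyFiniteOrderBot U] [LinearOrder B] [LinearOrder L]
    {X : Type} (encX : X → List Sym) (𝒲 : Set (Web U B L)) (𝒳 : Set X)
    (DP : Set (Web U B L × X)) : Prop :=
  ∃ M : LDMachine, ∀ W ∈ 𝒲, ∀ x ∈ 𝒳,
    ((W, x) ∈ DP → M.HaltsIn code (encWeb code W) (encX x) M.accepting) ∧
    ((W, x) ∉ DP → M.HaltsIn code (encWeb code W) (encX x) M.rejecting)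

end Machine

/-- The finiteness problem: the pairs of a Web `W` and a SPARQL expression `P` such that the
full-Web result of `P` over `W` is finite. -/
def finitenessProblem (U B L V : Type) : Set (Web U B L × Expr U L V) :=
  {q | (fullWebEval q.2 q.1).Finite}

end LinkedData

/-! An LD machine learns about the Web only through the expand procedure, and one expand depends on
the answer for at most one URI. A halting run makes finitely many steps, so its outcome depends on
the documents of a finite set `F` of URIs only (`LDMachine.HaltsIn.exists_finite`).

Let every URI `u` have its own document with the single triple `(b u, q, q)`, where `b` is injective
and the query is `(?x, p, q)` with `p ≠ q`. The result is empty, so a decider must accept. Now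
replace the predicate by `p` in all documents outside the set `F` of this accepting run. The lookups
in `F` are unchanged, so the machine accepts again, but the result has become infinite because `U \
F` is infinite. The blank nodes of the document of `u` are exactly `{b u}`, so both requirements on
blank nodes hold.

What remains is to show that searching the infinite Web tape for `♯ enc(u) e ♯` really returns the
document of `u` and nothing else (`occursOn_encWeb_iff`). This is unique parsing: `♯` occurs in no
entry except at its end, and `⟪` marks the end of the URI. -/

namespace LinkedData

/-! ## Lists -/

section List

variable {α β : Type}

/-- Both sides are cut at their first `s`. This serves with `♯` to delimit entries of the Web tape
and with `⟪` to split an entry into URI and data. -/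
theorem append_cons_inj {s : α} {a a' b b' : List α} (ha : s ∉ a) (ha' : s ∉ a')
    (h : a ++ s :: b = a' ++ s :: b') : a = a' ∧ b = b' := by
  induction a generalizing a' with
  | nil =>
    cases a' with
    | nil => simpa using h
    | cons x l =>
      simp only [List.nil_append, List.cons_append, List.cons.injEq] at h
      exact absurd (by simp [h.1]) ha'
  | cons y t ih =>
    cases a' with
    | nil =>
      simp only [List.nil_append, List.cons_append, List.cons.injEq] at h
      exact absurd (by simp [h.1]) ha
    | cons x l =>
      simp only [List.cons_append, List.cons.injEq] at h
      obtain ⟨h1, h2⟩ := ih (fun hm => ha (List.mem_cons_of_mem _ hm))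
        (fun hm => ha' (List.mem_cons_of_mem _ hm)) h.2
      exact ⟨by rw [h.1, h1], h2⟩

/-- The `s` after `p` cannot lie inside `g`, so `p` covers `g`. The remaining equation again has a
leading separator on the right, which is the form needed to go on to the next block. -/
theorem exists_append_of_append_cons_eq {s : α} {g rest p t : List α} (hg : s ∉ g)
    (h : p ++ s :: t = g ++ s :: rest) : ∃ p', p = g ++ p' ∧ p' ++ s :: t = s :: rest := by
  induction g generalizing p with
  | nil => exact ⟨p, rfl, h⟩
  | cons x g ih =>
    cases p with
    | nil =>
      simp only [List.nil_append, List.cons_append, List.cons.injEq] at h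
      exact absurd (by simp [h.1]) hg
    | cons y p =>
      simp only [List.cons_append, List.cons.injEq] at h
      obtain ⟨p', h1, h2⟩ := ih (fun hm => hg (List.mem_cons_of_mem _ hm)) h.2
      exact ⟨p', by rw [h.1, h1, List.cons_append], h2⟩

/-- In a word of blocks that are terminated by a separator `s`, a word between two consecutive
separators is a block. -/
theorem exists_mem_of_infix_flatMap {s : α} {f : β → List α}
    (hf : ∀ x, f x = [] ∨ ∃ g, s ∉ g ∧ f x = g ++ [s]) {w : List α} (hw : s ∉ w) {l : List β}
    (h : s :: (w ++ [s]) <:+: s :: l.flatMap f) : ∃ x ∈ l, f x = w ++ [s] := by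
  obtain ⟨p, t, h⟩ := h
  induction l generalizing p with
  | nil =>
    have := congrArg List.length h
    simp at this
    omega
  | cons x l ih =>
    rcases hf x with hx | ⟨g, hg, hx⟩
    · obtain ⟨y, hy, hy'⟩ := ih p (by simpa [hx] using h)
      exact ⟨y, List.mem_cons_of_mem _ hy, hy'⟩
    · cases p with
      | nil =>
        -- The occurrence starts at the leading separator, so `w` is the first nonempty block.
        have h' : w ++ s :: t = g ++ s :: l.flatMap f := by simpa [hx] using h
        exact ⟨x, List.mem_cons_self, by rw [hx, (append_cons_inj hw hg h').1]⟩
      | cons y p =>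
        -- The occurrence starts later; the separator that ends the first block becomes the leading
        -- one for the rest.
        have h' : p ++ s :: (w ++ s :: t) = g ++ s :: l.flatMap f := by
          simpa [hx] using (List.cons.inj h).2
        obtain ⟨p', -, hp'⟩ := exists_append_of_append_cons_eq hg h'
        obtain ⟨y, hy, hy'⟩ := ih p' (by simpa using hp')
        exact ⟨y, List.mem_cons_of_mem _ hy, hy'⟩

/-- Every element of the difference of the two intervals exceeds `u`, so its sorted list can be put
behind that of `Iic u`. -/
theorem sort_Iic_prefix [LinearOrder α] [LocallyFiniteOrderBot α] {u v : α} (h : u ≤ v) :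
    (Finset.Iic u).sort <+: (Finset.Iic v).sort := by
  refine ⟨(Finset.Iic v \ Finset.Iic u).sort, ?_⟩
  refine List.Perm.eq_of_pairwise' (r := (· ≤ ·)) ?_ (Finset.pairwise_sort _ _) ?_
  · rw [List.pairwise_append]
    refine ⟨Finset.pairwise_sort _ _, Finset.pairwise_sort _ _, fun a ha b hb => ?_⟩
    simp only [Finset.mem_sort, Finset.mem_sdiff, Finset.mem_Iic, not_le] at ha hb
    exact ha.trans hb.2.le
  · rw [List.perm_ext_iff_of_nodup]
    · intro a
      simp only [List.mem_append, Finset.mem_sort, Finset.mem_sdiff, Finset.mem_Iic, not_le]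
      refine ⟨fun ha => ha.elim (fun ha => ha.trans h) And.left, fun ha => ?_⟩
      rcases le_or_gt a u with hu | hu
      · exact Or.inl hu
      · exact Or.inr ⟨ha, hu⟩
    · refine List.Nodup.append (Finset.sort_nodup _ _) (Finset.sort_nodup _ _) ?_
      intro a ha hb
      simp only [Finset.mem_sort, Finset.mem_sdiff] at ha hb
      exact hb.2 ha
    · exact Finset.sort_nodup _ _

end List

/-! ## The content of the Web tape -/

section WebTape

variable {U B L V : Type} (code : Term U B L ⊕ V → List Bool)

theorem exists_bit_of_mem_encTerm {x : Term U B L} {s : Sym} (h : s ∈ encTerm code x) :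
    ∃ b, s = Sym.bit b := by
  obtain ⟨b, -, hb⟩ := List.mem_map.1 h
  exact ⟨b, hb.symm⟩

theorem encTerm_injective (hcode : Function.Injective code) :
    Function.Injective (encTerm code) := by
  intro x y h
  exact Sum.inl_injective (hcode (List.map_injective_iff.2 (fun a b h => Sym.bit.inj h) h))

theorem sharp_notMem_encTerm (x : Term U B L) : Sym.sharp ∉ encTerm code x := fun h => by
  obtain ⟨b, hb⟩ := exists_bit_of_mem_encTerm code h
  cases hb

theorem llangle_notMem_encTerm (x : Term U B L) : Sym.llangle ∉ encTerm code x := fun h => by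
  obtain ⟨b, hb⟩ := exists_bit_of_mem_encTerm code h
  cases hb

theorem sharp_notMem_encTriple (t : Triple U B L) : Sym.sharp ∉ encTriple code t := by
  simp [encTriple, sharp_notMem_encTerm]

theorem mem_intercalate {α : Type} {a : α} {sep : List α} {l : List (List α)}
    (h : a ∈ List.intercalate sep l) : a ∈ sep ∨ ∃ w ∈ l, a ∈ w := by
  simp only [List.intercalate, List.mem_flatten] at h
  obtain ⟨w, hw, ha⟩ := h
  by_cases hs : w = sep
  · exact Or.inl (hs ▸ ha)
  · right
    refine ⟨w, ?_, ha⟩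
    clear ha
    induction l using List.twoStepInduction with
    | nil => simp at hw
    | singleton x => simpa using hw
    | cons_cons x y l _ ih =>
      simp only [List.intersperse_cons_cons, List.mem_cons] at hw ih ⊢
      rcases hw with hw | hw | hw
      · exact Or.inl hw
      · exact absurd hw hs
      · exact Or.inr (ih y hw)

variable [LinearOrder U] [LinearOrder B] [LinearOrder L]

theorem sharp_notMem_encTriples (T : Finset (Triple U B L)) :
    Sym.sharp ∉ encTriples code T := by
  intro h
  simp only [encTriples, List.mem_append, List.mem_singleton, reduceCtorEq, false_or,
    or_false] at h
  rcases mem_intercalate h with h | ⟨w, hw, h⟩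
  · simp at h
  · obtain ⟨t, -, rfl⟩ := List.mem_map.1 hw
    exact sharp_notMem_encTriple code t h

theorem exists_encTriples_eq_cons (T : Finset (Triple U B L)) :
    ∃ w, encTriples code T = Sym.llangle :: w :=
  ⟨_, by rw [encTriples, List.append_assoc, List.singleton_append]⟩

/-- The binary representation need not be prefix-free; the bracket `⟪` shows where the URI ends.
Equality of the encoded data suffices, since a lookup returns only the word. -/
theorem encTerm_append_encTriples_inj (hcode : Function.Injective code) {x y : Term U B L}
    {S T : Finset (Triple U B L)}
    (h : encTerm code x ++ encTriples code S = encTerm code y ++ encTriples code T) :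
    x = y ∧ encTriples code S = encTriples code T := by
  obtain ⟨w, hw⟩ := exists_encTriples_eq_cons code S
  obtain ⟨w', hw'⟩ := exists_encTriples_eq_cons code T
  rw [hw, hw'] at h ⊢
  obtain ⟨h1, h2⟩ :=
    append_cons_inj (llangle_notMem_encTerm code x) (llangle_notMem_encTerm code y) h
  exact ⟨encTerm_injective code hcode h1, by rw [h2]⟩

theorem encEntry_of_adoc_eq_some {W : Web U B L} {u : U} {d : W.Doc} (h : W.adoc u = some d) :
    encEntry code W u =
      encTerm code (.uri u) ++ encTriples code (W.data d) ++ [Sym.sharp] := by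
  unfold encEntry
  rw [h]

theorem encEntry_eq_nil_or (W : Web U B L) (u : U) :
    encEntry code W u = [] ∨ ∃ g, Sym.sharp ∉ g ∧ encEntry code W u = g ++ [Sym.sharp] := by
  unfold encEntry
  split
  · exact Or.inl rfl
  · refine Or.inr ⟨_, ?_, rfl⟩
    simp [sharp_notMem_encTerm, sharp_notMem_encTriples]

variable [LocallyFiniteOrderBot U]

theorem encWebUpTo_prefix (W : Web U B L) {u v : U} (h : u ≤ v) :
    encWebUpTo code W u <+: encWebUpTo code W v := by
  obtain ⟨l, hl⟩ := sort_Iic_prefix h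
  refine ⟨l.flatMap (encEntry code W), ?_⟩
  simp only [encWebUpTo, ← hl, List.flatMap_append, List.append_assoc]

/-- `encWeb` reads from an arbitrarily chosen finite word; as these words form a chain of prefixes,
the choice does not matter. -/
theorem encWeb_eq_of_lt_length (W : Web U B L) {u : U} {k : ℕ}
    (hk : k < (encWebUpTo code W u).length) : encWeb code W k = (encWebUpTo code W u)[k]? := by
  have h : ∃ u, k < (encWebUpTo code W u).length := ⟨u, hk⟩
  rw [encWeb, dif_pos h]
  have hk' := h.choose_spec
  rcases le_total u h.choose with huv | huv
  · have := (encWebUpTo_prefix code W huv).getElem hk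
    rw [List.getElem?_eq_getElem hk, List.getElem?_eq_getElem hk', this]
  · have := (encWebUpTo_prefix code W huv).getElem hk'
    rw [List.getElem?_eq_getElem hk, List.getElem?_eq_getElem hk', this]

theorem exists_lt_length_of_encWeb_ne_none (W : Web U B L) {k : ℕ} (hk : encWeb code W k ≠ none) :
    ∃ u, k < (encWebUpTo code W u).length := by
  by_contra h
  exact hk (dif_neg h)

theorem OccursOn.exists_infix {W : Web U B L} {w : List Sym} (hw : w ≠ [])
    (h : OccursOn (encWeb code W) w) : ∃ u, w <:+: encWebUpTo code W u := by
  obtain ⟨i, hi⟩ := h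
  have hpos : 0 < w.length := List.length_pos_iff.2 hw
  -- The cell of the last letter of `w` is not blank; a finite word that reaches this cell contains
  -- the whole occurrence.
  obtain ⟨u, hu⟩ := exists_lt_length_of_encWeb_ne_none code W (k := i + (w.length - 1))
    (by rw [hi _ (by omega)]; simp)
  refine ⟨u, (List.infix_iff_getElem?).2 ⟨i, by omega, fun j hj => ?_⟩⟩
  rw [add_comm j i, ← encWeb_eq_of_lt_length code W (by omega), hi j hj]

theorem occursOn_of_infix {W : Web U B L} {w : List Sym} {u : U}
    (h : w <:+: encWebUpTo code W u) : OccursOn (encWeb code W) w := by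
  obtain ⟨i, hlen, hi⟩ := (List.infix_iff_getElem?).1 h
  refine ⟨i, fun j hj => ?_⟩
  rw [encWeb_eq_of_lt_length code W (u := u) (by omega), add_comm i j, hi j hj]

theorem infix_encWebUpTo {W : Web U B L} {u : U} {d : W.Doc} (h : W.adoc u = some d) :
    [Sym.sharp] ++ encTerm code (.uri u) ++ encTriples code (W.data d) ++ [Sym.sharp] <:+:
      encWebUpTo code W u := by
  obtain ⟨l, l', hl⟩ := List.append_of_mem ((Finset.mem_sort (· ≤ ·)).2 (Finset.mem_Iic.2 le_rfl) :
    u ∈ (Finset.Iic u).sort)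
  -- The `♯` in front of the entry of `u` ends the last nonempty entry before it, or is the initial
  -- `♯` of the tape if there is none. Empty entries, from URIs outside the domain of `adoc`, are
  -- filtered out to find it.
  have hsuf : [Sym.sharp] <:+ [Sym.sharp] ++ l.flatMap (encEntry code W) := by
    rcases List.eq_nil_or_concat ((l.map (encEntry code W)).filter (· ≠ [])) with h0 | ⟨m, w, h0⟩
    · have : l.flatMap (encEntry code W) = [] := by
        simpa [List.filter_eq_nil_iff] using h0
      rw [this, List.append_nil]
    · have hw : w ∈ (l.map (encEntry code W)).filter (· ≠ []) := by rw [h0]; simp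
      have hfl : l.flatMap (encEntry code W) = m.flatten ++ w := by
        rw [List.flatMap_def, ← List.flatten_filter_ne_nil, h0]
        simp
      simp only [List.mem_filter, List.mem_map, decide_eq_true_eq] at hw
      obtain ⟨⟨x, -, rfl⟩, hx⟩ := hw
      rcases encEntry_eq_nil_or code W x with h1 | ⟨g, -, h1⟩
      · exact absurd h1 hx
      · exact ⟨[Sym.sharp] ++ m.flatten ++ g, by rw [hfl, h1]; simp⟩
  obtain ⟨p, hp⟩ := hsuf
  refine ⟨p, l'.flatMap (encEntry code W), ?_⟩
  rw [encWebUpTo, hl, List.flatMap_append, List.flatMap_cons, encEntry_of_adoc_eq_some code h,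
    ← List.append_assoc [Sym.sharp], ← hp]
  simp

/-- The word `♯ enc(u) e ♯`, where `e` encodes a document, occurs on the Web tape if and only if
`e` is the encoding of the document for `u`. -/
theorem occursOn_encWeb_iff (hcode : Function.Injective code) (W : Web U B L) (u : U)
    (T : Finset (Triple U B L)) :
    OccursOn (encWeb code W)
        ([.sharp] ++ encTerm code (.uri u) ++ encTriples code T ++ [.sharp]) ↔
      ∃ d, W.adoc u = some d ∧ encTriples code T = encTriples code (W.data d) := by
  constructor
  · intro h
    obtain ⟨v, hv⟩ := OccursOn.exists_infix code (by simp) h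
    obtain ⟨x, -, hx⟩ := exists_mem_of_infix_flatMap (s := Sym.sharp)
      (w := encTerm code (.uri u) ++ encTriples code T) (f := encEntry code W)
      (encEntry_eq_nil_or code W) (by simp [sharp_notMem_encTerm, sharp_notMem_encTriples])
      (l := (Finset.Iic v).sort) (by simpa [encWebUpTo] using hv)
    cases hd : W.adoc x with
    | none => simp [encEntry, hd] at hx
    | some d =>
      rw [encEntry_of_adoc_eq_some code hd] at hx
      obtain ⟨h1, h2⟩ :=
        encTerm_append_encTriples_inj code hcode (List.append_cancel_right hx)
      cases h1
      exact ⟨d, hd, h2.symm⟩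
  · rintro ⟨d, hd, hT⟩
    rw [hT]
    exact occursOn_of_infix code (infix_encWebUpTo code hd)

end WebTape

/-! ## Runs of LD machines -/

section Run

variable {U B L V : Type} (code : Term U B L ⊕ V → List Bool) {Aux : Type}

/-- Two longest suffixes of one word have equal length, hence are equal. So each expand concerns at
most one URI. -/
theorem IsURISuffix.unique (hcode : Function.Injective code) {w : List (Cell Aux)} {u v : U}
    (hu : IsURISuffix code w u) (hv : IsURISuffix code w v) : u = v := by
  have hlen := le_antisymm (hv.2 u hu.1) (hu.2 v hv.1)
  have h := (List.suffix_of_suffix_length_le hu.1 hv.1 (by simp [hlen])).eq_of_length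
    (by simp [hlen])
  have h' := List.map_injective_iff.2
    (fun a b (h : (some (Sum.inl a) : Cell Aux) = some (Sum.inl b)) => by simpa using h) h
  simpa using encTerm_injective code hcode h'

variable [LinearOrder U] [LinearOrder B] [LinearOrder L]

/-- Two Web tapes give the same results of looking up `u`. -/
def SameLookup (τ τ' : ℕ → Option Sym) (u : U) : Prop :=
  ∀ T : Finset (Triple U B L),
    OccursOn τ ([.sharp] ++ encTerm code (.uri u) ++ encTriples code T ++ [.sharp]) ↔
      OccursOn τ' ([.sharp] ++ encTerm code (.uri u) ++ encTriples code T ++ [.sharp])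

theorem expandTape_eq_of_sameLookup {τ τ' : ℕ → Option Sym} {t : RightTape Aux}
    (h : ∀ u, IsURISuffix code t.word u → SameLookup code τ τ' u) :
    expandTape code τ t = expandTape code τ' t := by
  -- Once the predicates are equal, `expandTape` makes the same choice for both tapes, and
  -- uniqueness of lookup results is not needed.
  have : IsLookupResult code τ t.word = IsLookupResult code τ' t.word := by
    funext e
    refine propext (exists_congr fun u => and_congr_right fun hu => and_congr_right ?_)
    rintro ⟨T, rfl⟩
    exact h u hu T
  unfold expandTape
  rw [this]

theorem LDMachine.step_eq_of_sameLookup (M : LDMachine) {τ τ' : ℕ → Option Sym} {c : Config M}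
    (h : ∀ u, IsURISuffix code c.link.word u → SameLookup code τ τ' u) :
    M.step code τ c = M.step code τ' c := by
  rw [step, step, expandIfNeeded, expandIfNeeded, expandTape_eq_of_sameLookup code h]

/-- A halting computation looks up finitely many URIs. -/
theorem LDMachine.HaltsIn.exists_finite (hcode : Function.Injective code) {M : LDMachine}
    {τ : ℕ → Option Sym} {x : List Sym} {S : Set M.State} (h : M.HaltsIn code τ x S) :
    ∃ F : Set U, F.Finite ∧ ∀ τ', (∀ u ∈ F, SameLookup code τ τ' u) →
      M.HaltsIn code τ' x S := by
  obtain ⟨c, hc, hS⟩ := h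
  obtain ⟨hreach, hhalt⟩ := StateTransition.mem_eval.1 hc
  have hfin (c : Config M) : {u | IsURISuffix code c.link.word u}.Finite :=
    Set.Subsingleton.finite fun u hu v hv => IsURISuffix.unique code hcode hu hv
  -- `F` is collected along the run on `τ` and is fixed before `τ'` is given.
  have key : ∃ F : Set U, F.Finite ∧ ∀ τ', (∀ u ∈ F, SameLookup code τ τ' u) →
      StateTransition.Reaches (M.step code τ') (M.init x) c := by
    clear hc hS hhalt
    induction hreach with
    | refl => exact ⟨∅, Set.finite_empty, fun _ _ => Relation.ReflTransGen.refl⟩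
    | @tail c c' _ hstep ih =>
      obtain ⟨F, hF, ih⟩ := ih
      refine ⟨F ∪ {u | IsURISuffix code c.link.word u}, hF.union (hfin c), fun τ' hτ' => ?_⟩
      refine (ih τ' fun u hu => hτ' u (Or.inl hu)).tail ?_
      rwa [← M.step_eq_of_sameLookup code fun u hu => hτ' u (Or.inr hu)]
  obtain ⟨F, hF, hreach'⟩ := key
  -- The final configuration may also be in the expand state, so that it halts can depend on one
  -- more lookup.
  refine ⟨F ∪ {u | IsURISuffix code c.link.word u}, hF.union (hfin c), fun τ' hτ' => ?_⟩
  refine ⟨c, StateTransition.mem_eval.2 ⟨hreach' τ' fun u hu => hτ' u (Or.inl hu), ?_⟩, hS⟩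
  rwa [← M.step_eq_of_sameLookup code fun u hu => hτ' u (Or.inr hu)]

/-- The machine is deterministic: the halting configuration is unique, and its state lies in both
sets. -/
theorem LDMachine.HaltsIn.not_disjoint {M : LDMachine} {τ : ℕ → Option Sym} {x : List Sym}
    {S T : Set M.State} (hS : M.HaltsIn code τ x S) (hT : M.HaltsIn code τ x T) :
    ¬ Disjoint S T := by
  obtain ⟨c, hc, hcS⟩ := hS
  obtain ⟨c', hc', hcT⟩ := hT
  rw [Part.mem_unique hc' hc] at hcT
  exact Set.not_disjoint_iff.2 ⟨_, hcS, hcT⟩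

end Run

/-! ## Webs that are indistinguishable by finitely many lookups -/

section Adversary

variable {U B L V : Type}

/-- The expression that asks for the subjects `?x` of triples `(?x, p, q)`. -/
def subjectQuery (L : Type) (x : V) (p q : U) : Expr U L V :=
  .tp ⟨Sum.inl x, Sum.inr p, Sum.inr (Sum.inl q)⟩

open Classical in
theorem mem_eval_subjectQuery {p q : U} {x : V} {G : Set (Triple U B L)} {c : B}
    (h : (⟨Sum.inr c, p, .uri q⟩ : Triple U B L) ∈ G) :
    (fun v => if v = x then some (Term.bnode c) else none) ∈ (subjectQuery L x p q).eval G := by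
  refine ⟨?_, _, h, ?_, ?_, ?_⟩
  · ext v
    simp [Valuation.dom, TriplePattern.vars, eq_comm]
  · simp [Valuation.instVU, Triple.subjTerm]
  · simp [Valuation.instVU]
  · simp [Valuation.instVUL, constTerm]

theorem subjectQuery_satisfiable [Nonempty B] (x : V) (p q : U) :
    (subjectQuery L x p q).Satisfiable B :=
  ⟨{⟨Sum.inr (Classical.arbitrary B), p, .uri q⟩}, _,
    mem_eval_subjectQuery (Set.mem_singleton _)⟩

open Classical in
/-- The Web in which every URI `u` has its own document, whose only triple has the subject `b u`,
the predicate `p` if `u ∈ S` and else `q`, and the object `q`. -/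
noncomputable def markedWeb (L : Type) [Countable U] (b : U → B) (p q : U) (S : Set U) :
    Web U B L where
  Doc := U
  countable_doc := inferInstance
  data u := {⟨Sum.inr (b u), if u ∈ S then p else q, .uri q⟩}
  adoc u := some u
  adoc_surjective u := ⟨u, rfl⟩

variable [Countable U] {b : U → B} {p q : U} {S : Set U}

theorem mem_docBNodes_markedWeb {u : U} {c : B} :
    c ∈ (markedWeb L b p q S).docBNodes u ↔ c = b u := by
  simp [Web.docBNodes, bnodes, markedWeb, Triple.terms, Triple.subjTerm]

theorem markedWeb_disjointBNodes (hb : Function.Injective b) :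
    (markedWeb L b p q S).DisjointBNodes := fun (u v : U) huv =>
  Set.disjoint_left.2 fun _ hc hc' => hb.ne (a₁ := u) (a₂ := v) huv
    (((mem_docBNodes_markedWeb (u := u)).1 hc).symm.trans
      ((mem_docBNodes_markedWeb (u := v)).1 hc'))

/-- Disjointness alone would allow two documents without blank nodes; here `b u` is always present.
-/
theorem markedWeb_uniqueBNodes (hb : Function.Injective b) :
    (markedWeb L b p q S).UniqueBNodes := fun (u v : U) huv h =>
  hb.ne (a₁ := u) (a₂ := v) huv
    ((mem_docBNodes_markedWeb (u := v)).1 (h ▸ (mem_docBNodes_markedWeb (u := u)).2 rfl))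

theorem mem_allData_markedWeb {t : Triple U B L} :
    t ∈ (markedWeb L b p q S).allData ↔
      ∃ u, (u ∈ S ∧ t = ⟨Sum.inr (b u), p, .uri q⟩) ∨
        (u ∉ S ∧ t = ⟨Sum.inr (b u), q, .uri q⟩) := by
  simp only [Web.allData, Set.mem_iUnion, markedWeb, Finset.coe_singleton, Set.mem_singleton_iff]
  refine exists_congr fun u => ?_
  by_cases hu : u ∈ S <;> simp [hu]

theorem fullWebEval_markedWeb_empty (x : V) (hpq : p ≠ q) :
    fullWebEval (subjectQuery L x p q) (markedWeb L b p q ∅) = ∅ := by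
  rw [Set.eq_empty_iff_forall_notMem]
  rintro μ ⟨-, t, ht, -, h, -⟩
  obtain ⟨u, ⟨hu, -⟩ | ⟨-, rfl⟩⟩ := mem_allData_markedWeb.1 ht
  · exact hu
  · exact hpq (by simpa [Valuation.instVU] using h)

/-- Each `u ∈ S` contributes the solution `?x ↦ b u`, and these are distinct as `b` is injective. -/
theorem fullWebEval_markedWeb_infinite (x : V) (hb : Function.Injective b) (hS : S.Infinite) :
    (fullWebEval (subjectQuery L x p q) (markedWeb L b p q S)).Infinite := by
  classical
  refine Set.infinite_of_injOn_mapsTo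
    (f := fun u v => if v = x then some (Term.bnode (b u)) else none) ?_ ?_ hS
  · intro u _ v _ huv
    have := congrFun huv x
    simp only [if_true, Option.some.injEq, Term.bnode.injEq] at this
    exact hb this
  · intro u hu
    exact mem_eval_subjectQuery (mem_allData_markedWeb.2 ⟨u, Or.inl ⟨hu, rfl⟩⟩)

/-- A lookup of `u` sees only the document of `u`, which depends on the marked set only through
membership of `u`. -/
theorem sameLookup_markedWeb [LinearOrder U] [LocallyFiniteOrderBot U] [LinearOrder B]
    [LinearOrder L] (code : Term U B L ⊕ V → List Bool) (hcode : Function.Injective code)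
    {S' : Set U} {u : U} (h : u ∈ S ↔ u ∈ S') :
    SameLookup code (encWeb code (markedWeb L b p q S)) (encWeb code (markedWeb L b p q S'))
      u := by
  intro T
  rw [occursOn_encWeb_iff code hcode, occursOn_encWeb_iff code hcode]
  by_cases hu : u ∈ S <;> simp [markedWeb, hu, ← h]

/-- Finiteness of full-Web results is undecidable for every class of Webs that contains the Webs
`markedWeb` for injective `b`. -/
theorem not_decidable_of_markedWeb_mem [Infinite U] [Infinite B] [Nonempty V]
    [LinearOrder U] [LocallyFiniteOrderBot U] [LinearOrder B] [LinearOrder L]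
    (code : Term U B L ⊕ V → List Bool) (hcode : Function.Injective code)
    (𝒲 : Set (Web U B L))
    (h𝒲 : ∀ (b : U → B) (p q : U) (S : Set U), Function.Injective b → markedWeb L b p q S ∈ 𝒲) :
    ¬ LDMachineDecidable code (encExpr code) 𝒲 {P : Expr U L V | P.Satisfiable B}
        (finitenessProblem U B L V) := by
  rintro ⟨M, hM⟩
  -- A supply of distinct blank nodes: the countable `U` embeds into `ℕ`, and `ℕ` into the infinite
  -- `B`.
  obtain ⟨f, hf⟩ := exists_injective_nat U
  have hb : Function.Injective (Infinite.natEmbedding B ∘ f) :=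
    (Infinite.natEmbedding B).injective.comp hf
  set b : U → B := Infinite.natEmbedding B ∘ f
  obtain ⟨p, q, hpq⟩ := exists_pair_ne U
  let x : V := Classical.arbitrary V
  have hP : (subjectQuery L x p q).Satisfiable B := subjectQuery_satisfiable x p q
  have hacc := (hM _ (h𝒲 b p q ∅ hb) _ hP).1 <| by
    change (fullWebEval _ _).Finite
    rw [fullWebEval_markedWeb_empty x hpq]
    exact Set.finite_empty
  obtain ⟨F, hF, hrun⟩ := hacc.exists_finite code hcode
  -- Marking exactly the URIs outside `F` agrees with marking none on `F`, so the accepting run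
  -- persists.
  have hacc' := hrun (encWeb code (markedWeb L b p q Fᶜ)) fun u hu =>
    sameLookup_markedWeb code hcode (by simp [hu])
  have hrej := (hM _ (h𝒲 b p q Fᶜ hb) _ hP).2
    (fullWebEval_markedWeb_infinite x hb hF.infinite_compl)
  exact hacc'.not_disjoint code hrej M.disjoint_accepting_rejecting

end Adversary

end LinkedData

theorem mainTheorem8 (U B L V : Type)
    [Countable U] [Infinite U] [Countable B] [Infinite B]
    [Countable L] [Infinite L] [Countable V] [Infinite V]
    [LinearOrder U] [LocallyFiniteOrderBot U] [LinearOrder B] [LinearOrder L]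
    (code : LinkedData.Term U B L ⊕ V → List Bool) (hcode : Function.Injective code) :
    ¬ LinkedData.LDMachineDecidable code (LinkedData.encExpr code)
        {W : LinkedData.Web U B L | W.UniqueBNodes}
        {P : LinkedData.Expr U L V | P.Satisfiable B}
        (LinkedData.finitenessProblem U B L V) ∧
    ¬ LinkedData.LDMachineDecidable code (LinkedData.encExpr code)
        {W : LinkedData.Web U B L | W.DisjointBNodes}
        {P : LinkedData.Expr U L V | P.Satisfiable B}
        (LinkedData.finitenessProblem U B L V) :=
  ⟨LinkedData.not_decidable_of_markedWeb_mem code hcode _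
      fun _ _ _ _ hb => LinkedData.markedWeb_uniqueBNodes hb,
    LinkedData.not_decidable_of_markedWeb_mem code hcode _
      fun _ _ _ _ hb => LinkedData.markedWeb_disjointBNodes hb⟩
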